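/- Let $\alpha$ be a natural number with $\alpha\ge 3$. The formulas of $\alpha$-variable first-order logic $L_\alpha$ are built from the atomic formulas $R_k(v_{i_1},\dots,v_{i_\alpha})$ ($k<\omega$, $i_1,\dots,i_\alpha<\alpha$) and $v_i=v_j$ ($i,j<\alpha$) by means of $\lnot$, $\lor$ and $\exists v_i$ ($i<\alpha$), where $v_0,\dots,v_{\alpha-1}$ are the only variables and $R_0,R_1,\dots$ are $\alpha$-place relation symbols; $\varphi\to\psi$ abbreviates $\lnot\varphi\lor\psi$ and $\forall v_i\varphi$ abbreviates $\lnot\exists v_i\lnot\varphi$. A formula is a tautology if it is true in every model under every evaluation of the variables. For $\tau:\alpha\to\alpha$ define $S(\tau)\varphi$ by recursion: $S(\tau)R_k(v_{i_1},\dots,v_{i_\alpha})$ is $R_k(v_{\tau(i_1)},\dots,v_{\tau(i_\alpha)})$; $S(\tau)(v_i=v_j)$ is $v_{\tau(i)}=v_{\tau(j)}$; $S(\tau)$ commutes with $\lnot$ and $\lor$; and $S(\tau)\exists v_i\varphi$ is $\exists v_jS(\sigma)\varphi$, where $j$ is the least element of $\alpha\setminus\{\tau(k): i\ne k<\alpha\}$,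 $\sigma(i)=j$ and $\sigma(k)=\tau(k)$ for $k\ne i$. For an assignment $\delta$ of formulas to the relation symbols, the corresponding instance of $\varphi$ is obtained from $\varphi$ by substituting $S(\tau)\delta(R_k)$ for each atomic formula $R_k(v_{\tau(0)},\dots,v_{\tau(\alpha-1)})$, simultaneously for all $k$ and $\tau$. For a set $\Gamma$ of formulas, $\mathrm{Inst}(\Gamma)$ is the set of all instances of members of $\Gamma$. A complete axiom system for $L_\alpha$ is a set $\Gamma$ of tautologies such that every tautology can be derived from $\mathrm{Inst}(\Gamma)$ by repeated use of Detachment (from $\varphi$ and $\varphi\to\psi$ infer $\psi$) and Generalization (from $\varphi$ infer $\forall v_i\varphi$, $i<\alpha$). Theorem. Every complete axiom system $\Gamma$ for $L_\alpha$ contains, for each $n<\omega$, a formula $\varphi$ with the following three properties: (i) at least $n$ distinct relation symbols occur in $\varphi$; (ii) both $R_i(v_{\tau(0)},\dots,v_{\tau(\alpha-1)})$ and $R_i(v_{\sigma(0)},\dots,v_{\sigma(\alpha-1)})$ occur in $\varphi$, for some $i<\omega$ and some distinct permutations $\tau,\sigma$ of $\alpha$; (iii) the existential quantifier $\exists$,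 the equality symbol $=$ and the disjunction symbol $\lor$ all occur in $\varphi$. -/

import Mathlib

universe u

namespace FinVarLogic

/-- Formulas of `α`-variable first-order logic `L_α`. The variables are `v_i` (`i : Fin α`), the
relation symbols are `R_k` (`k : ℕ`), all of them `α`-place. `rel k f` is the atomic formula
`R_k(v_{f 0}, …, v_{f (α-1)})` and `eq i j` is the atomic formula `v_i = v_j`. -/
inductive Fm (α : ℕ) : Type
  | rel (k : ℕ) (f : Fin α → Fin α) : Fm α
  | eq (i j : Fin α) : Fm α
  | neg (φ : Fm α) : Fm α
  | or (φ ψ : Fm α) : Fm α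
  | ex (i : Fin α) (φ : Fm α) : Fm α

namespace Fm

variable {α : ℕ}

/-- `φ → ψ` as a derived connective. -/
def imp (φ ψ : Fm α) : Fm α := or (neg φ) ψ

/-- `∀ v_i φ` as a derived connective. -/
def all (i : Fin α) (φ : Fm α) : Fm α := neg (ex i (neg φ))

/-- Truth of a formula in the model with universe `M` in which `R_k` is interpreted by `R k`,
under the evaluation `a` of the variables. -/
def Sat {M : Type*} (R : ℕ → (Fin α → M) → Prop) : (Fin α → M) → Fm α → Prop
  | a, rel k f => R k (fun l => a (f l))
  | a, eq i j => a i = a j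
  | a, neg φ => ¬ Sat R a φ
  | a, or φ ψ => Sat R a φ ∨ Sat R a ψ
  | a, ex i φ => ∃ u : M, Sat R (Function.update a i u) φ

/-- `φ` is valid (a tautology): true in each model under each evaluation of the variables. -/
def Valid (φ : Fm α) : Prop :=
  ∀ (M : Type u) [Nonempty M] (R : ℕ → (Fin α → M) → Prop) (a : Fin α → M), Sat R a φ

theorem fresh_nonempty (τ : Fin α → Fin α) (i : Fin α) :
    (Finset.univ \ (Finset.univ.erase i).image τ).Nonempty := by
  rw [← Finset.card_pos]
  have h1 := Finset.card_image_le (s := Finset.univ.erase i) (f := τ)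
  have h2 := Finset.le_card_sdiff ((Finset.univ.erase i).image τ) Finset.univ
  have h3 := Finset.card_erase_lt_of_mem (Finset.mem_univ i)
  omega

/-- The least element of `α ∖ {τ k | k ≠ i}`. -/
def fresh (τ : Fin α → Fin α) (i : Fin α) : Fin α :=
  (Finset.univ \ (Finset.univ.erase i).image τ).min' (fresh_nonempty τ i)

/-- `S(τ)φ`: the version of `φ` in which each `v_j` is systematically replaced by `v_{τ j}`, with
renaming of bound variables. -/
def subst : (Fin α → Fin α) → Fm α → Fm α
  | τ, rel k f => rel k (fun l => τ (f l))
  | τ, eq i j => eq (τ i) (τ j)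
  | τ, neg φ => neg (subst τ φ)
  | τ, or φ ψ => or (subst τ φ) (subst τ ψ)
  | τ, ex i φ => ex (fresh τ i) (subst (Function.update τ i (fresh τ i)) φ)

/-- The instance of a formula given by the assignment `δ` of formulas to relation symbols:
`S(f) δ(R_k)` is substituted for each `R_k(v_{f 0}, …, v_{f (α-1)})`, simultaneously. -/
def inst (δ : ℕ → Fm α) : Fm α → Fm α
  | rel k f => subst f (δ k)
  | eq i j => eq i j
  | neg φ => neg (inst δ φ)
  | or φ ψ => or (inst δ φ) (inst δ ψ)
  | ex i φ => ex i (inst δ φ)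

/-- `Inst(Γ)`: the set of all instances of members of `Γ`. -/
def Inst (Γ : Set (Fm α)) : Set (Fm α) :=
  {ψ | ∃ φ ∈ Γ, ∃ δ : ℕ → Fm α, ψ = inst δ φ}

/-- Derivability from a set of formulas by Detachment and Generalization. -/
inductive Derivable (Δ : Set (Fm α)) : Fm α → Prop
  | mem {φ : Fm α} : φ ∈ Δ → Derivable Δ φ
  | detachment {φ ψ : Fm α} : Derivable Δ φ → Derivable Δ (imp φ ψ) → Derivable Δ ψ
  | generalization {φ : Fm α} (i : Fin α) : Derivable Δ φ → Derivable Δ (all i φ)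

/-- `Γ` is a complete axiom system for `L_α`: a set of tautologies such that every tautology is
derivable from `Inst(Γ)` by Detachment and Generalization. -/
def IsCompleteAxiomSystem (Γ : Set (Fm α)) : Prop :=
  (∀ φ ∈ Γ, Valid.{u} φ) ∧ ∀ φ : Fm α, Valid.{u} φ → Derivable (Inst Γ) φ

/-- The finite set of (indices of) relation symbols that occur in a formula. -/
def relSymbols : Fm α → Finset ℕ
  | rel k _ => {k}
  | eq _ _ => ∅
  | neg φ => relSymbols φ
  | or φ ψ => relSymbols φ ∪ relSymbols ψ
  | ex _ φ => relSymbols φ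

/-- The atomic formula `R_k(v_{f 0}, …, v_{f (α-1)})` occurs in a formula. -/
def RelOccurs (k : ℕ) (f : Fin α → Fin α) : Fm α → Prop
  | rel k' f' => k' = k ∧ f' = f
  | eq _ _ => False
  | neg φ => RelOccurs k f φ
  | or φ ψ => RelOccurs k f φ ∨ RelOccurs k f ψ
  | ex _ φ => RelOccurs k f φ

/-- The existential quantifier occurs in a formula. -/
def ExOccurs : Fm α → Prop
  | rel _ _ => False
  | eq _ _ => False
  | neg φ => ExOccurs φ
  | or φ ψ => ExOccurs φ ∨ ExOccurs ψ
  | ex _ _ => True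

/-- The equality symbol occurs in a formula. -/
def EqOccurs : Fm α → Prop
  | rel _ _ => False
  | eq _ _ => True
  | neg φ => EqOccurs φ
  | or φ ψ => EqOccurs φ ∨ EqOccurs ψ
  | ex _ φ => EqOccurs φ

/-- The disjunction symbol occurs in a formula. -/
def OrOccurs : Fm α → Prop
  | rel _ _ => False
  | eq _ _ => False
  | neg φ => OrOccurs φ
  | or _ _ => True
  | ex _ φ => OrOccurs φ

end Fm

end FinVarLogic

/-! Soundness is tested in nonstandard structures whose states are pairs of an evaluation and a
colour; a quantifier rebinds its variable together with the colour. Instances and both rules behave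
there as in ordinary models (`cSat_inst`, `Derivable.cSat`), but a tautology may fail. The one that
fails says that the complete graph on `2 * N + 1` points does not split into `2 * N` symmetric
colour classes each meeting every point: a class would be a perfect matching of an odd set
(`false_of_odd_factorization`). With colours in `ZMod (2 * N)` carried by the state, such a
splitting is simulated (`cSat_oddFactorization_coloredRel`).

If no member of `Γ` had the properties for `n`, every member would hold in this structure, for a
suitable `N`, under every interpretation of its symbols by definable relations. The reason is a
transfer to an ordinary model (`sat_iff_cSat_of_coloring`): colours become a function of the
evaluation that takes all relevant values when one coordinate changes. Such a function exists if
there are few relation symbols, since then at most `N` colour types matter and a symmetric function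
of differences realises them; if no symbol occurs under two permutations, since then symmetry is not
needed; or if equality is absent, since then points can be duplicated. Without `∃` the colour never
changes, and without `∨` there is at most one relation symbol. -/

namespace FinVarLogic

namespace Fm

/-! ### Coloured semantics, its soundness, and transfer to ordinary models -/

section ColoredSemantics

variable {α : ℕ} {U J : Type*}

/-- Truth in a structure whose states are pairs of an evaluation and a colour: a quantifier
rebinds its variable and the colour, a substitution leaves the colour unchanged. -/
def CSat (X : ℕ → (Fin α → U) → J → Prop) : (Fin α → U) → J → Fm α → Prop
  | s, c, rel k f => X k (fun l => s (f l)) c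
  | s, _, eq i j => s i = s j
  | s, c, neg φ => ¬ CSat X s c φ
  | s, c, or φ ψ => CSat X s c φ ∨ CSat X s c ψ
  | s, _, ex i φ => ∃ (v : U) (c' : J), CSat X (Function.update s i v) c' φ

theorem sat_iff_cSat (R : ℕ → (Fin α → U) → Prop) (φ : Fm α) (a : Fin α → U) :
    Sat R a φ ↔ CSat (fun k s (_ : Unit) => R k s) a () φ := by
  induction φ generalizing a with
  | rel k f => rfl
  | eq i j => rfl
  | neg φ ih => exact not_congr (ih a)
  | or φ ψ ih1 ih2 => exact or_congr (ih1 a) (ih2 a)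
  | ex i φ ih =>
    refine exists_congr fun v => (ih _).trans ⟨fun h => ⟨(), h⟩, fun ⟨_, h⟩ => h⟩

theorem fresh_ne (τ : Fin α → Fin α) {i k : Fin α} (h : k ≠ i) : τ k ≠ fresh τ i := by
  have h1 := Finset.min'_mem _ (fresh_nonempty τ i)
  intro h2
  refine (Finset.mem_sdiff.1 h1).2 (Finset.mem_image.2 ⟨k, ?_, h2⟩)
  simpa using h

theorem update_fresh_comp (τ : Fin α → Fin α) (i : Fin α) (s : Fin α → U) (v : U) :
    (fun l => Function.update s (fresh τ i) v (Function.update τ i (fresh τ i) l)) =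
      Function.update (fun l => s (τ l)) i v := by
  funext l
  by_cases h : l = i
  · subst h; simp
  · simp [Function.update_of_ne h, Function.update_of_ne (fresh_ne τ h)]

theorem cSat_subst (X : ℕ → (Fin α → U) → J → Prop) (φ : Fm α) (τ : Fin α → Fin α)
    (s : Fin α → U) (c : J) :
    CSat X s c (subst τ φ) ↔ CSat X (fun l => s (τ l)) c φ := by
  induction φ generalizing τ s c with
  | rel k f => rfl
  | eq i j => rfl
  | neg φ ih => exact not_congr (ih τ s c)
  | or φ ψ ih1 ih2 => exact or_congr (ih1 τ s c) (ih2 τ s c)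
  | ex i φ ih =>
    refine exists_congr fun v => exists_congr fun c' => (ih _ _ _).trans ?_
    rw [update_fresh_comp]

/-- Relations may depend on the colour and substitution preserves it, so the truth set of each `δ k`
is again an admissible interpretation. Soundness for instances thus reduces to soundness for the
axioms. -/
theorem cSat_inst (X : ℕ → (Fin α → U) → J → Prop) (δ : ℕ → Fm α) (φ : Fm α)
    (s : Fin α → U) (c : J) :
    CSat X s c (inst δ φ) ↔ CSat (fun k s c => CSat X s c (δ k)) s c φ := by
  induction φ generalizing s c with
  | rel k f => exact cSat_subst X (δ k) f s c
  | eq i j => rfl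
  | neg φ ih => exact not_congr (ih s c)
  | or φ ψ ih1 ih2 => exact or_congr (ih1 s c) (ih2 s c)
  | ex i φ ih => exact exists_congr fun v => exists_congr fun c' => ih _ _

theorem cSat_imp {X : ℕ → (Fin α → U) → J → Prop} {φ ψ : Fm α} {s : Fin α → U} {c : J} :
    CSat X s c (imp φ ψ) ↔ (CSat X s c φ → CSat X s c ψ) := imp_iff_not_or.symm

theorem cSat_all {X : ℕ → (Fin α → U) → J → Prop} {φ : Fm α} {i : Fin α} {s : Fin α → U}
    {c : J} : CSat X s c (all i φ) ↔ ∀ v c', CSat X (Function.update s i v) c' φ := by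
  simp [all, CSat]

/-- The rules preserve truth in all states. -/
theorem Derivable.cSat {X : ℕ → (Fin α → U) → J → Prop} {Δ : Set (Fm α)}
    (hΔ : ∀ φ ∈ Δ, ∀ s c, CSat X s c φ) {φ : Fm α} (h : Derivable Δ φ) :
    ∀ s c, CSat X s c φ := by
  induction h with
  | mem h => exact hΔ _ h
  | detachment _ _ ih1 ih2 => exact fun s c => cSat_imp.1 (ih2 s c) (ih1 s c)
  | generalization i _ ih => exact fun s c => cSat_all.2 fun v c' => ih _ _

/-- A quantifier discards the current colour, so only atomic formulas outside quantifiers can see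
it. -/
theorem cSat_congr_color {Q : Type*} {q : J → Q} {A : Set ℕ}
    {X : ℕ → (Fin α → U) → J → Prop}
    (hX : ∀ k ∈ A, ∀ s c c', q c = q c' → (X k s c ↔ X k s c')) (φ : Fm α)
    (hφ : ∀ k ∈ φ.relSymbols, k ∈ A) (s : Fin α → U) {c c' : J} (hc : q c = q c') :
    CSat X s c φ ↔ CSat X s c' φ := by
  induction φ generalizing s with
  | rel k f => exact hX k (hφ k (by simp [relSymbols])) _ _ _ hc
  | eq i j => rfl
  | neg φ ih => exact not_congr (ih hφ s)
  | or φ ψ ih1 ih2 =>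
    simp only [relSymbols, Finset.mem_union] at hφ
    exact or_congr (ih1 (fun k h => hφ k (.inl h)) s) (ih2 (fun k h => hφ k (.inr h)) s)
  | ex i φ ih => rfl

/-- Transfer from a coloured structure to an ordinary model over it along `p`, whose evaluations
are coloured by `κ`. -/
theorem sat_iff_cSat_of_coloring {M : Type*} (p : M → U) {A : Set ℕ}
    (X : ℕ → (Fin α → U) → J → Prop) (κ : (Fin α → M) → J) (R : ℕ → (Fin α → M) → Prop)
    (hline : ∀ (t : Fin α → M) i u c, ∃ v, ∀ ψ : Fm α, (∀ k ∈ ψ.relSymbols, k ∈ A) →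
      CSat X (Function.update (p ∘ t) i u) c ψ →
      CSat X (p ∘ Function.update t i v) (κ (Function.update t i v)) ψ)
    (φ : Fm α) (hφ : ∀ k ∈ φ.relSymbols, k ∈ A)
    (hrel : ∀ k f, RelOccurs k f φ → ∀ t : Fin α → M,
      (R k (fun l => t (f l)) ↔ X k (fun l => p (t (f l))) (κ t)))
    (heq : EqOccurs φ → Function.Injective p) (t : Fin α → M) :
    Sat R t φ ↔ CSat X (p ∘ t) (κ t) φ := by
  induction φ generalizing t with
  | rel k f => exact hrel k f ⟨rfl, rfl⟩ t
  | eq i j => exact ((heq trivial).eq_iff).symm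
  | neg φ ih => exact not_congr (ih hφ hrel heq t)
  | or φ ψ ih1 ih2 =>
    simp only [relSymbols, Finset.mem_union] at hφ
    exact or_congr
      (ih1 (fun k h => hφ k (.inl h)) (fun k f h => hrel k f (.inl h)) (fun h => heq (.inl h)) t)
      (ih2 (fun k h => hφ k (.inr h)) (fun k f h => hrel k f (.inr h)) (fun h => heq (.inr h)) t)
  | ex i φ ih =>
    constructor
    · rintro ⟨v, hv⟩
      refine ⟨p v, κ (Function.update t i v), ?_⟩
      rw [← Function.comp_update]
      exact (ih hφ hrel heq _).1 hv
    · rintro ⟨u, c, h⟩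
      -- The pair `(u, c)` need not come from a point of `M`; `hline` replaces it by one that does
      -- and preserves the truth of formulas over `A`.
      obtain ⟨v, hv⟩ := hline t i u c
      exact ⟨v, (ih hφ hrel heq _).2 (hv φ hφ h)⟩

theorem sat_iff_cSat_of_not_exOccurs (X : ℕ → (Fin α → U) → J → Prop) (c : J) (φ : Fm α)
    (hφ : ¬ ExOccurs φ) (s : Fin α → U) :
    Sat (fun k s => X k s c) s φ ↔ CSat X s c φ := by
  induction φ with
  | rel k f => rfl
  | eq i j => rfl
  | neg φ ih => exact not_congr (ih hφ)
  | or φ ψ ih1 ih2 =>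
    exact or_congr (ih1 fun h => hφ (.inl h)) (ih2 fun h => hφ (.inr h))
  | ex i φ => exact absurd trivial hφ

theorem sat_comp_equiv {M N : Type*} (e : M ≃ N) (R : ℕ → (Fin α → N) → Prop) (φ : Fm α)
    (a : Fin α → M) : Sat (fun k s => R k (e ∘ s)) a φ ↔ Sat R (e ∘ a) φ := by
  induction φ generalizing a with
  | rel k f => rfl
  | eq i j => exact (e.injective.eq_iff).symm
  | neg φ ih => exact not_congr (ih a)
  | or φ ψ ih1 ih2 => exact or_congr (ih1 a) (ih2 a)
  | ex i φ ih =>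
    refine Iff.trans (exists_congr fun v => ?_) e.surjective.exists.symm
    rw [ih, Function.comp_update]

/-- A valid formula holds in the models over types in the lowest universe. -/
theorem Valid.sat {φ : Fm α} (h : Valid.{u} φ) {M : Type} [Nonempty M]
    (R : ℕ → (Fin α → M) → Prop) (a : Fin α → M) : Sat R a φ :=
  (sat_comp_equiv Equiv.ulift.{u} R φ (ULift.up ∘ a)).1 (h (ULift.{u} M) _ _)

theorem card_relSymbols_le_one {φ : Fm α} (h : ¬ OrOccurs φ) : φ.relSymbols.card ≤ 1 := by
  induction φ with
  | rel k f => simp [relSymbols]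
  | eq i j => simp [relSymbols]
  | neg φ ih => exact ih h
  | or φ ψ => exact absurd trivial h
  | ex i φ ih => exact ih h

theorem mem_relSymbols_of_relOccurs {k : ℕ} {f : Fin α → Fin α} {φ : Fm α}
    (h : RelOccurs k f φ) : k ∈ φ.relSymbols := by
  induction φ with
  | rel k' f' => simpa [relSymbols] using h.1.symm
  | eq i j => exact h.elim
  | neg φ ih => exact ih h
  | or φ ψ ih1 ih2 => exact Finset.mem_union.2 (h.imp ih1 ih2)
  | ex i φ ih => exact ih h

end ColoredSemantics

end Fm

end FinVarLogic

/-! ### The universe of points and its symmetries -/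

namespace FinVarLogic

/-- The points of the universe: elements of `ZMod m`, natural numbers, and permutations of
`ZMod m`. -/
inductive Pt (m : ℕ) : Type
  | v (x : ZMod m) : Pt m
  | z (n : ℕ) : Pt m
  | w (e : Equiv.Perm (ZMod m)) : Pt m

namespace Pt

variable {m α : ℕ}

/-- The point is an element of `ZMod m`. -/
def isV : Pt m → Bool
  | v _ => true
  | _ => false

/-- The element of `ZMod m`, and zero for the other points. -/
def vval : Pt m → ZMod m
  | v x => x
  | _ => 0

/-- The natural number, and zero for the other points. -/
def zval : Pt m → ℕ
  | z n => n
  | _ => 0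

/-- The action of a pair of permutations on the points. -/
def perm (π : Equiv.Perm (ZMod m)) (ρ : Equiv.Perm ℕ) : Equiv.Perm (Pt m) where
  toFun
    | v x => v (π x)
    | z n => z (ρ n)
    | w e => w (π.symm.trans e)
  invFun
    | v x => v (π.symm x)
    | z n => z (ρ.symm n)
    | w e => w (π.trans e)
  left_inv := by
    rintro (x | n | e) <;> simp
    ext; simp
  right_inv := by
    rintro (x | n | e) <;> simp
    ext; simp

theorem isV_perm (π : Equiv.Perm (ZMod m)) (ρ : Equiv.Perm ℕ) (p : Pt m) :
    (perm π ρ p).isV = p.isV := by cases p <;> rfl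

theorem eq_v_of_isV {p : Pt m} (h : p.isV = true) : p = v p.vval := by
  cases p <;> simp_all [isV, vval]

theorem vval_of_not_isV {p : Pt m} (h : ¬ p.isV = true) : p.vval = 0 := by
  cases p <;> simp_all [isV, vval]

theorem eq_z {p : Pt m} (h : ¬ p.isV = true) (hw : ∀ e, p ≠ w e) : p = z p.zval := by
  cases p <;> simp_all [isV, zval]

/-- The set of the coordinates that lie in `ZMod m`. -/
def vset (s : Fin α → Pt m) : Finset (Fin α) := Finset.univ.filter fun a => (s a).isV = true

theorem mem_vset {s : Fin α → Pt m} {a : Fin α} : a ∈ vset s ↔ (s a).isV = true := by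
  simp [vset]

/-- The evaluations that carry a colour: injective ones with exactly two coordinates in `ZMod m`
and all the others natural numbers. -/
def Star (s : Fin α → Pt m) : Prop :=
  Function.Injective s ∧ (vset s).card = 2 ∧ ∀ a e, s a ≠ w e

theorem vset_perm_comp (π : Equiv.Perm (ZMod m)) (ρ : Equiv.Perm ℕ) (s : Fin α → Pt m) :
    vset (perm π ρ ∘ s) = vset s := by
  ext a; simp [mem_vset, isV_perm]

theorem star_perm_comp (π : Equiv.Perm (ZMod m)) (ρ : Equiv.Perm ℕ) (s : Fin α → Pt m) :
    Star (perm π ρ ∘ s) ↔ Star s := by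
  refine and_congr ?_ (and_congr (by rw [vset_perm_comp]) ?_)
  · exact (perm π ρ).injective.of_comp_iff s
  · refine forall_congr' fun a => ?_
    have : ∀ p : Pt m, (∀ e, perm π ρ p ≠ w e) ↔ ∀ e, p ≠ w e := by
      rintro (x | n | e) <;> simp [perm]
    exact this _

theorem card_vset_comp (s : Fin α → Pt m) (τ : Equiv.Perm (Fin α)) :
    (vset fun l => s (τ l)).card = (vset s).card :=
  Finset.card_equiv τ fun a => by simp [mem_vset]

theorem star_comp_iff (s : Fin α → Pt m) (τ : Equiv.Perm (Fin α)) :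
    Star (fun l => s (τ l)) ↔ Star s := by
  refine and_congr ?_ (and_congr (by rw [card_vset_comp]) ?_)
  · exact τ.injective_comp s
  · exact (τ.surjective.forall (p := fun a => ∀ e, s a ≠ w e)).symm

theorem exists_perm_of_star_comp {s : Fin α → Pt m} {f : Fin α → Fin α}
    (h : Star fun l => s (f l)) : ∃ τ : Equiv.Perm (Fin α), f = fun l => τ l := by
  have hf : Function.Injective f := Function.Injective.of_comp (f := s) h.1
  exact ⟨Equiv.ofBijective f (Finite.injective_iff_bijective.1 hf), rfl⟩

theorem star_of_star_comp {s : Fin α → Pt m} {f : Fin α → Fin α}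
    (h : Star fun l => s (f l)) : Star s := by
  obtain ⟨τ, rfl⟩ := exists_perm_of_star_comp h
  exact (star_comp_iff s τ).1 h

theorem Star.eq_of_vval_eq {s : Fin α → Pt m} (hs : Star s) {a b : Fin α} (ha : a ∈ vset s)
    (hb : b ∈ vset s) (h : (s a).vval = (s b).vval) : a = b :=
  hs.1 ((eq_v_of_isV (mem_vset.1 ha)).trans ((congrArg v h).trans
    (eq_v_of_isV (mem_vset.1 hb)).symm))

theorem Star.eq_of_zval_eq {s : Fin α → Pt m} (hs : Star s) {a b : Fin α} (ha : a ∉ vset s)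
    (hb : b ∉ vset s) (h : (s a).zval = (s b).zval) : a = b :=
  hs.1 ((eq_z (mem_vset.not.1 ha) (hs.2.2 a)).trans ((congrArg z h).trans
    (eq_z (mem_vset.not.1 hb) (hs.2.2 b)).symm))

/-- By injectivity, the partial maps between the values in `ZMod m` and between the natural numbers
extend to permutations, independently of each other. Points `w e` are excluded from `Star` because
`perm` does not move them freely. -/
theorem exists_perm_comp_eq {s t : Fin α → Pt m} (hs : Star s) (ht : Star t)
    (h : vset s = vset t) : ∃ π ρ, perm π ρ ∘ s = t := by
  obtain ⟨π, hπ⟩ := Equiv.Perm.exists_extending_pair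
    (fun a : {a // a ∈ vset s} => (s a).vval) (fun a => (t a).vval)
    (fun a b hab => Subtype.ext (hs.eq_of_vval_eq a.2 b.2 hab))
    (fun a b hab => Subtype.ext (ht.eq_of_vval_eq (h ▸ a.2) (h ▸ b.2) hab))
  obtain ⟨ρ, hρ⟩ := Equiv.Perm.exists_extending_pair
    (fun a : {a // a ∉ vset s} => (s a).zval) (fun a => (t a).zval)
    (fun a b hab => Subtype.ext (hs.eq_of_zval_eq a.2 b.2 hab))
    (fun a b hab => Subtype.ext (ht.eq_of_zval_eq (h ▸ a.2) (h ▸ b.2) hab))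
  refine ⟨π, ρ, funext fun a => ?_⟩
  by_cases ha : a ∈ vset s
  · have h1 := eq_v_of_isV (mem_vset.1 ha)
    have h2 := eq_v_of_isV (mem_vset.1 (h ▸ ha))
    rw [Function.comp_apply, h1, h2]
    exact congrArg v (hπ ⟨a, ha⟩)
  · have h1 := eq_z (mem_vset.not.1 ha) (hs.2.2 _)
    have h2 := eq_z (mem_vset.not.1 (h ▸ ha)) (ht.2.2 _)
    rw [Function.comp_apply, h1, h2]
    exact congrArg z (hρ ⟨a, ha⟩)

/-- A coloured relation that depends on the colour in `Star` only and is invariant under the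
action of permutations on the points. -/
def Good {J : Type*} (X : (Fin α → Pt m) → J → Prop) : Prop :=
  (∀ s c c', ¬ Star s → (X s c ↔ X s c')) ∧ ∀ π ρ s c, X (perm π ρ ∘ s) c ↔ X s c

/-- Needed for the interpretations that instances produce. -/
theorem good_cSat {J : Type*} {X : ℕ → (Fin α → Pt m) → J → Prop} (hX : ∀ k, Good (X k))
    (φ : Fm α) : Good fun s c => Fm.CSat X s c φ := by
  induction φ with
  | rel k f =>
    exact ⟨fun s c c' h => (hX k).1 _ _ _ (mt star_of_star_comp h), fun π ρ s c =>
      (hX k).2 π ρ (fun l => s (f l)) c⟩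
  | eq i j => exact ⟨fun _ _ _ _ => Iff.rfl, fun π ρ s c => (perm π ρ).injective.eq_iff⟩
  | neg φ ih =>
    exact ⟨fun s c c' h => not_congr (ih.1 s c c' h), fun π ρ s c => not_congr (ih.2 π ρ s c)⟩
  | or φ ψ ih1 ih2 =>
    exact ⟨fun s c c' h => or_congr (ih1.1 s c c' h) (ih2.1 s c c' h),
      fun π ρ s c => or_congr (ih1.2 π ρ s c) (ih2.2 π ρ s c)⟩
  | ex i φ ih =>
    refine ⟨fun _ _ _ _ => Iff.rfl, fun π ρ s c => ?_⟩
    refine (perm π ρ).surjective.exists.trans (exists_congr fun v => exists_congr fun c' => ?_)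
    rw [← Function.comp_update]
    exact ih.2 π ρ _ _

theorem Good.congr_star {J : Type*} {X : (Fin α → Pt m) → J → Prop} (hX : Good X)
    {s t : Fin α → Pt m} (hs : Star s) (ht : Star t) (h : vset s = vset t) (c : J) :
    X s c ↔ X t c := by
  obtain ⟨π, ρ, rfl⟩ := exists_perm_comp_eq hs ht h
  exact (hX.2 π ρ s c).symm

/-! ### Colourings of evaluations by differences and sums -/

/-- The difference of the two coordinates in `ZMod m`, in increasing order of coordinates. -/
def diff (s : Fin α → Pt m) : ZMod m :=
  ∑ a ∈ vset s, ∑ b ∈ vset s, if a < b then (s a).vval - (s b).vval else 0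

/-- The sum of the coordinates that are natural numbers. -/
def zsum (s : Fin α → Pt m) : ℕ := ∑ a, (s a).zval

theorem diff_eq {s : Fin α → Pt m} {a b : Fin α} (h : vset s = {a, b}) (hab : a < b) :
    diff s = (s a).vval - (s b).vval := by
  simp [diff, h, Finset.sum_pair hab.ne, hab, hab.not_gt]

theorem diff_comp_perm {s : Fin α → Pt m} (h : (vset s).card = 2) (τ : Equiv.Perm (Fin α)) :
    diff (fun l => s (τ l)) = diff s ∨ diff (fun l => s (τ l)) = - diff s := by
  obtain ⟨a, b, hab, hT⟩ : ∃ a b, a < b ∧ vset s = {a, b} := by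
    obtain ⟨a, b, hab, hT⟩ := Finset.card_eq_two.1 h
    rcases lt_or_gt_of_ne hab with h | h
    · exact ⟨a, b, h, hT⟩
    · exact ⟨b, a, h, by rw [hT, Finset.pair_comm]⟩
  have hT' : vset (fun l => s (τ l)) = {τ.symm a, τ.symm b} := by
    ext l
    have := Finset.ext_iff.1 hT (τ l)
    simp only [mem_vset, Finset.mem_insert, Finset.mem_singleton] at this ⊢
    rw [this, Equiv.eq_symm_apply, Equiv.eq_symm_apply]
  rw [diff_eq hT hab]
  have hne : τ.symm a ≠ τ.symm b := τ.symm.injective.ne hab.ne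
  rcases lt_or_gt_of_ne hne with h | h
  · left
    rw [diff_eq hT' h]; simp
  · right
    rw [diff_eq (hT'.trans (Finset.pair_comm _ _)) h]; simp

theorem zsum_comp_perm (s : Fin α → Pt m) (τ : Equiv.Perm (Fin α)) :
    zsum (fun l => s (τ l)) = zsum s := Equiv.sum_comp τ fun a => (s a).zval

theorem vset_update {s : Fin α → Pt m} {i : Fin α} {p : Pt m} (hp : p.isV = (s i).isV) :
    vset (Function.update s i p) = vset s := by
  ext a
  by_cases h : a = i
  · subst h; simp [mem_vset, hp]
  · simp [mem_vset, h]

theorem Star.update {s : Fin α → Pt m} (hs : Star s) {i : Fin α} {p : Pt m}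
    (hp : p.isV = (s i).isV) (hw : ∀ e, p ≠ w e) (hne : ∀ a, a ≠ i → s a ≠ p) :
    Star (Function.update s i p) := by
  refine ⟨?_, by rw [vset_update hp]; exact hs.2.1, fun a e => ?_⟩
  · intro a b hab
    by_cases ha : a = i <;> by_cases hb : b = i
    · rw [ha, hb]
    · subst ha
      rw [Function.update_self, Function.update_of_ne hb] at hab
      exact absurd hab.symm (hne b hb)
    · subst hb
      rw [Function.update_self, Function.update_of_ne ha] at hab
      exact absurd hab (hne a ha)
    · rw [Function.update_of_ne ha, Function.update_of_ne hb] at hab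
      exact hs.1 hab
  · by_cases ha : a = i
    · subst ha; simpa using hw e
    · simpa [ha] using hs.2.2 a e

/-- The colour of an evaluation in `ZMod P` given by a function `h` of the difference. -/
def col (P : ℕ) (h : ZMod m → ℕ) (s : Fin α → Pt m) : ZMod P := h (diff s) + zsum s

/-- A coordinate in `ZMod m` is moved to adjust the difference, a natural-number coordinate to
adjust the sum. The condition `d ≠ 0` keeps the two elements of `ZMod m` distinct. -/
theorem exists_update_col {P : ℕ} [NeZero P] {h : ZMod m → ℕ}
    (hh : ∀ r : ZMod P, ∃ d ≠ 0, (h d : ZMod P) = r) {s : Fin α → Pt m} (hs : Star s)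
    (i : Fin α) (r : ZMod P) :
    ∃ p, Star (Function.update s i p) ∧ vset (Function.update s i p) = vset s ∧
      col P h (Function.update s i p) = r := by
  by_cases hi : i ∈ vset s
  · have hiV := mem_vset.1 hi
    obtain ⟨b, hbi, hT⟩ : ∃ b, b ≠ i ∧ vset s = {i, b} := by
      obtain ⟨a, b, hab, hT⟩ := Finset.card_eq_two.1 hs.2.1
      rw [hT] at hi
      rcases Finset.mem_insert.1 hi with rfl | hi
      · exact ⟨b, hab.symm, hT⟩
      · rw [Finset.mem_singleton.1 hi]
        exact ⟨a, hab, hT.trans (Finset.pair_comm _ _)⟩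
    obtain ⟨d, hd, hdr⟩ := hh (r - zsum s)
    have key : ∀ x, x ≠ (s b).vval → diff (Function.update s i (v x)) = d →
        ∃ p, Star (Function.update s i p) ∧ vset (Function.update s i p) = vset s ∧
          col P h (Function.update s i p) = r := by
      intro x hx hxd
      have hV : (v x : Pt m).isV = (s i).isV := by rw [hiV]; rfl
      refine ⟨v x, hs.update hV (by simp) ?_, vset_update hV, ?_⟩
      · intro a ha hax
        have : a ∈ vset s := by rw [mem_vset, hax]; rfl
        rw [hT, Finset.mem_insert, Finset.mem_singleton] at this
        rcases this with rfl | rfl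
        · exact ha rfl
        · apply hx; rw [hax]; rfl
      · have hz : zsum (Function.update s i (v x)) = zsum s := by
          refine Finset.sum_congr rfl fun a _ => ?_
          by_cases ha : a = i
          · subst ha
            rw [Function.update_self, eq_v_of_isV hiV]; rfl
          · rw [Function.update_of_ne ha]
        rw [col, hxd, hdr, hz]; ring
    have hvs : ∀ x, vset (Function.update s i (v x)) = {i, b} := fun x => by
      rw [vset_update (by rw [hiV]; rfl), hT]
    rcases lt_or_gt_of_ne hbi with hlt | hlt
    · refine key ((s b).vval - d) (by simpa using hd) ?_
      rw [diff_eq ((hvs _).trans (Finset.pair_comm _ _)) hlt]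
      simp [hbi, vval]
    · refine key ((s b).vval + d) (by simpa using hd) ?_
      rw [diff_eq (hvs _) hlt]
      simp [hbi, vval]
  · have hiV := mem_vset.not.1 hi
    have hval : ∀ a, (s a).zval ≤ zsum s := fun a =>
      Finset.single_le_sum (f := fun a => (s a).zval) (fun _ _ => Nat.zero_le _)
        (Finset.mem_univ a)
    set S : ℕ := ∑ a ∈ Finset.univ.erase i, (s a).zval
    -- The multiple of `P` leaves the colour alone and makes `n` exceed every natural number among
    -- the coordinates.
    set n : ℕ := (r - h (diff s) - S : ZMod P).val + P * (zsum s + 1) with hn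
    have hV : (z n : Pt m).isV = (s i).isV := by
      rw [Bool.not_eq_true] at hiV; rw [hiV]; rfl
    have hlt : zsum s < n := by
      have : zsum s + 1 ≤ P * (zsum s + 1) := Nat.le_mul_of_pos_left _ (NeZero.pos P)
      omega
    refine ⟨z n, hs.update hV (by simp) ?_, vset_update hV, ?_⟩
    · intro a _ hax
      have := hval a
      rw [hax] at this
      exact absurd this hlt.not_ge
    · have hd : diff (Function.update s i (z n)) = diff s := by
        have : ∀ a, (Function.update s i (z n) a).vval = (s a).vval := by
          intro a
          by_cases ha : a = i
          · subst ha
            rw [Function.update_self, vval_of_not_isV hiV]; rfl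
          · rw [Function.update_of_ne ha]
        simp only [diff, vset_update hV, this]
      have hz : zsum (Function.update s i (z n)) = n + S := by
        rw [zsum, ← Finset.add_sum_erase _ _ (Finset.mem_univ i), Function.update_self]
        refine congrArg (n + ·) (Finset.sum_congr rfl fun a ha => ?_)
        rw [Function.update_of_ne (Finset.ne_of_mem_erase ha)]
      rw [col, hd, hz, hn]
      push_cast
      rw [ZMod.natCast_zmod_val, ZMod.natCast_self]
      ring

theorem col_comp_perm {P : ℕ} {h : ZMod m → ℕ} (hh : ∀ d, h (-d) = h d) {s : Fin α → Pt m}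
    (hs : Star s) (τ : Equiv.Perm (Fin α)) : col P h (fun l => s (τ l)) = col P h s := by
  rw [col, col, zsum_comp_perm]
  rcases diff_comp_perm hs.2.1 τ with h | h <;> rw [h]
  rw [hh]

end Pt

end FinVarLogic

namespace FinVarLogic

/-! ### Three classes of tautologies that hold in coloured structures -/

namespace Pt

open Fm

variable {m α : ℕ} {J : Type*} {X : ℕ → (Fin α → Pt m) → J → Prop}

instance : Nonempty (Pt m) := ⟨z 0⟩

theorem Good.congr_color_comp {Y : (Fin α → Pt m) → J → Prop} (hY : Good Y) {s : Fin α → Pt m}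
    {f : Fin α → Fin α} {c c' : J}
    (h : ∀ τ : Equiv.Perm (Fin α), f = (fun l => τ l) → Star s → (Y (fun l => s (τ l)) c ↔
      Y (fun l => s (τ l)) c')) :
    Y (fun l => s (f l)) c ↔ Y (fun l => s (f l)) c' := by
  by_cases hs : Star fun l => s (f l)
  · obtain ⟨τ, rfl⟩ := exists_perm_of_star_comp hs
    exact h τ rfl ((star_comp_iff s τ).1 hs)
  · exact hY.1 _ _ _ hs

/-- In `Star`, only `vset` and the colour class matter, so `u` may be exchanged for a point giving
the right class. Outside `Star` the colour is irrelevant and `u` itself serves. -/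
theorem exists_line (hX : ∀ k, Good (X k)) {P : ℕ} [NeZero P] {h : ZMod m → ℕ}
    (hh : ∀ r : ZMod P, ∃ d ≠ 0, (h d : ZMod P) = r) {q : J → ZMod P} {A : Set ℕ}
    (hA : ∀ k ∈ A, ∀ s c c', q c = q c' → (X k s c ↔ X k s c')) {e : ZMod P}
    {κ : (Fin α → Pt m) → J} (hκ : ∀ s, q (κ s) = col P h s + e)
    (t : Fin α → Pt m) (i : Fin α) (u : Pt m) (c : J) :
    ∃ v, ∀ ψ : Fm α, (∀ k ∈ ψ.relSymbols, k ∈ A) →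
      CSat X (Function.update (id ∘ t) i u) c ψ →
      CSat X (id ∘ Function.update t i v) (κ (Function.update t i v)) ψ := by
  by_cases hs : Star (Function.update t i u)
  · obtain ⟨p, hp, hv, hr⟩ := exists_update_col hh hs i (q c - e)
    rw [Function.update_idem] at hp hv hr
    refine ⟨p, fun ψ hψ hc => ?_⟩
    refine (cSat_congr_color hA ψ hψ _ ?_).1
      (((good_cSat hX ψ).congr_star hs hp hv.symm c).1 hc)
    rw [hκ, hr]; ring
  · exact ⟨u, fun ψ _ hc => ((good_cSat hX ψ).1 _ _ _ hs).1 hc⟩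

/-- Colours with equal `θ` are indistinguishable for `φ`, leaving at most `N` classes. The nonzero
differences up to sign take `N` values, enough for a colouring invariant under permuting the
variables, so all permuted occurrences of a symbol agree. -/
theorem cSat_of_valid_of_card_le {N n : ℕ} (hN : 2 ^ (n * 2 ^ α) ≤ N)
    {X : ℕ → (Fin α → Pt (2 * N + 1)) → J → Prop} (hX : ∀ k, Good (X k)) {φ : Fm α}
    (hφ : Valid.{u} φ) (hcard : φ.relSymbols.card ≤ n) (s : Fin α → Pt (2 * N + 1)) (c : J) :
    CSat X s c φ := by
  classical
  let θ : J → Set ({k // k ∈ φ.relSymbols} × Finset (Fin α)) :=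
    fun j => {x | ∃ s, Star s ∧ vset s = x.2 ∧ X x.1 s j}
  have : Nonempty (Set.range θ) := ⟨⟨θ c, c, rfl⟩⟩
  set P := Nat.card (Set.range θ) with hP
  have : NeZero P := ⟨Nat.card_pos.ne'⟩
  have hPN : P ≤ N := by
    refine le_trans ?_ hN
    refine (Nat.card_mono Set.finite_univ (Set.subset_univ _)).trans ?_
    rw [Nat.card_univ, Nat.card_eq_fintype_card, Fintype.card_set, Fintype.card_prod,
      Fintype.card_coe, Fintype.card_finset, Fintype.card_fin]
    exact Nat.pow_le_pow_right (by norm_num) (Nat.mul_le_mul_right _ hcard)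
  let e : Set.range θ ≃ ZMod P := (Finite.equivFin _).trans (ZMod.finEquiv P).toEquiv
  let q : J → ZMod P := fun j => e ⟨θ j, j, rfl⟩
  have hq : Function.Surjective q := by
    intro r
    obtain ⟨⟨_, j, rfl⟩, h⟩ := e.surjective r
    exact ⟨j, h⟩
  let h : ZMod (2 * N + 1) → ℕ := fun d => min d.val (-d).val
  have hh : ∀ r : ZMod P, ∃ d ≠ 0, (h d : ZMod P) = r := by
    intro r
    -- Representatives run from `1` to `P`, because the difference `0` is not available.
    obtain ⟨k, hk0, hkP, hk⟩ : ∃ k : ℕ, 0 < k ∧ k ≤ P ∧ (k : ZMod P) = r := by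
      by_cases hr : r = 0
      · exact ⟨P, NeZero.pos P, le_rfl, by simp [hr]⟩
      · exact ⟨r.val, Nat.pos_of_ne_zero (by simpa using hr), (ZMod.val_lt r).le,
          ZMod.natCast_zmod_val r⟩
    have hval : (k : ZMod (2 * N + 1)).val = k := ZMod.val_cast_of_lt (by omega)
    have hne : (k : ZMod (2 * N + 1)) ≠ 0 := fun h0 => by
      rw [h0, ZMod.val_zero] at hval; omega
    refine ⟨k, hne, ?_⟩
    have : NeZero (k : ZMod (2 * N + 1)) := ⟨hne⟩
    have : h k = k := by
      simp only [h]
      rw [ZMod.val_neg_of_ne_zero, hval]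
      omega
    rw [this, hk]
  have hA : ∀ k ∈ (φ.relSymbols : Set ℕ), ∀ s c c', q c = q c' → (X k s c ↔ X k s c') := by
    have key : ∀ k ∈ (φ.relSymbols : Set ℕ), ∀ s c c', q c = q c' → X k s c → X k s c' := by
      intro k hk s c c' hc hXc
      by_cases hs : Star s
      · have hθ : θ c = θ c' := congrArg Subtype.val (e.injective hc)
        have hmem : ((⟨k, hk⟩, vset s) : {k // k ∈ φ.relSymbols} × Finset (Fin α)) ∈ θ c' :=
          hθ ▸ ⟨s, hs, rfl, hXc⟩
        obtain ⟨s', hs', hv, hX'⟩ := hmem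
        exact ((hX k).congr_star hs' hs hv c').1 hX'
      · exact ((hX k).1 _ _ _ hs).1 hXc
    exact fun k hk s c c' hc => ⟨key k hk s c c' hc, key k hk s c' c hc.symm⟩
  let κ : (Fin α → Pt (2 * N + 1)) → J :=
    -- The shift puts the colour of `s` into the class of `c`.
    fun t => Function.surjInv hq (col P h t + (q c - col P h s))
  have hκ : ∀ t, q (κ t) = col P h t + (q c - col P h s) := fun t => Function.surjInv_eq hq _
  have hsat := (sat_iff_cSat_of_coloring id X κ (fun k t => X k t (κ t))
    (exists_line hX hh hA hκ) φ (fun k hk => hk) (fun k f hkf t =>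
      (hX k).congr_color_comp fun τ hτ ht => by
        refine hA k (mem_relSymbols_of_relOccurs hkf) _ _ _ ?_
        rw [hκ, hκ, hτ, col_comp_perm (fun d => by simp [h, min_comm]) ht])
    (fun _ => Function.injective_id) s).1 (hφ.sat _ _)
  refine (cSat_congr_color hA φ (fun k hk => hk) s ?_).1 hsat
  rw [hκ]; ring

/-- The colouring need not be symmetric here, so the `2 * N` nonzero differences realise all
colours. Each `R_k` is read through the inverse of the one permutation `σ k` under which it may
occur. -/
theorem cSat_of_valid_of_perm_unique {N : ℕ} [NeZero N]
    {X : ℕ → (Fin α → Pt (2 * N + 1)) → ZMod (2 * N) → Prop} (hX : ∀ k, Good (X k)) {φ : Fm α}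
    (hφ : Valid.{u} φ)
    (huniq : ∀ k, ∀ τ σ : Equiv.Perm (Fin α), φ.RelOccurs k (fun l => τ l) →
      φ.RelOccurs k (fun l => σ l) → τ = σ)
    (s : Fin α → Pt (2 * N + 1)) (c : ZMod (2 * N)) :
    CSat X s c φ := by
  have hσ : ∀ k, ∃ σ : Equiv.Perm (Fin α), ∀ τ : Equiv.Perm (Fin α),
      φ.RelOccurs k (fun l => τ l) → τ = σ := by
    intro k
    by_cases h : ∃ σ : Equiv.Perm (Fin α), φ.RelOccurs k (fun l => σ l)
    · obtain ⟨σ, hσ⟩ := h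
      exact ⟨σ, fun τ hτ => huniq k τ σ hτ hσ⟩
    · exact ⟨1, fun τ hτ => absurd ⟨τ, hτ⟩ h⟩
  choose σ hσ using hσ
  have hN : 0 < N := NeZero.pos N
  have hh : ∀ r : ZMod (2 * N), ∃ d : ZMod (2 * N + 1), d ≠ 0 ∧ (d.val : ZMod (2 * N)) = r := by
    intro r
    obtain ⟨k, hk0, hkP, hk⟩ : ∃ k : ℕ, 0 < k ∧ k ≤ 2 * N ∧ (k : ZMod (2 * N)) = r := by
      by_cases hr : r = 0
      · exact ⟨2 * N, by omega, le_rfl, by rw [hr, ZMod.natCast_self]⟩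
      · exact ⟨r.val, Nat.pos_of_ne_zero (by simpa using hr), (ZMod.val_lt r).le,
          ZMod.natCast_zmod_val r⟩
    have hval : (k : ZMod (2 * N + 1)).val = k := ZMod.val_cast_of_lt (by omega)
    exact ⟨k, fun h0 => by rw [h0, ZMod.val_zero] at hval; omega, by rw [hval, hk]⟩
  let κ : (Fin α → Pt (2 * N + 1)) → ZMod (2 * N) :=
    fun t => col (2 * N) ZMod.val t + (c - col (2 * N) ZMod.val s)
  have hA : ∀ k ∈ (Set.univ : Set ℕ), ∀ (s : Fin α → Pt (2 * N + 1)) (c c' : ZMod (2 * N)),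
      id c = id c' → (X k s c ↔ X k s c') := by
    rintro k - s c c' rfl; rfl
  have hsat := (sat_iff_cSat_of_coloring id X κ (fun k t => X k t (κ fun l => t ((σ k).symm l)))
    (exists_line hX hh hA fun _ => rfl) φ (fun k _ => Set.mem_univ k) (fun k f hkf t =>
      (hX k).congr_color_comp fun τ hτ ht => by
        subst hτ
        simp [hσ k τ hkf])
    (fun _ => Function.injective_id) s).1 (hφ.sat _ _)
  have : κ s = c := by simp [κ]
  rwa [this] at hsat

/-- Without equality each point may be replaced by copies indexed by `J`. The sum of the indices is
a symmetric colour, and changing any one index gives it any value. -/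
theorem cSat_of_valid_of_not_eqOccurs {J : Type} [AddCommGroup J]
    {X : ℕ → (Fin α → Pt m) → J → Prop} (hX : ∀ k, Good (X k)) {φ : Fm α}
    (hφ : Valid.{u} φ) (heq : ¬ EqOccurs φ) (s : Fin α → Pt m) (c : J) : CSat X s c φ := by
  let κ : (Fin α → Pt m × J) → J := fun t => ∑ a, (t a).2 + c
  have hsat := (sat_iff_cSat_of_coloring (A := Set.univ) Prod.fst X κ
    (fun k t => X k (fun l => (t l).1) (κ t)) (fun t i u c' => by
      refine ⟨(u, c' - c - ∑ a ∈ Finset.univ.erase i, (t a).2), fun ψ _ h => ?_⟩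
      have hsum : ∀ v, ∑ a ∈ Finset.univ.erase i, (Function.update t i v a).2 =
          ∑ a ∈ Finset.univ.erase i, (t a).2 := fun v =>
        Finset.sum_congr rfl fun a ha => by
          rw [Function.update_of_ne (Finset.ne_of_mem_erase ha)]
      convert h using 1
      · exact Function.comp_update _ _ _ _
      · simp only [κ]
        rw [← Finset.add_sum_erase _ _ (Finset.mem_univ i), Function.update_self, hsum]
        simp) φ (fun k _ => Set.mem_univ k) (fun k f _ t =>
      (hX k).congr_color_comp (s := fun l => (t l).1) fun τ hτ _ => by
        subst hτ
        simp only [κ]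
        rw [Equiv.sum_comp τ fun a => (t a).2])
    (fun h => absurd h heq) fun a => (s a, 0)).1 (hφ.sat _ _)
  simpa [κ, Function.comp_def] using hsat

end Pt

end FinVarLogic

/-! ### The odd factorization and the formula expressing it -/

namespace FinVarLogic

/-- The labels bound `V` by `2 * N + 1` elements, and the disjoint relations give each element `2 *
N` distinct neighbours, so equality holds and neighbours are unique. Then `C 0` is a
fixed-point-free involution on a set of odd size. -/
theorem false_of_odd_factorization {M : Type*} {N : ℕ} (hN : 0 < N) {V : M → Prop}
    {F : ℕ → M → Prop} {C : ℕ → M → M → Prop} (hV : ∃ x, V x)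
    (hF : ∀ x, V x → ∃ k < 2 * N + 1, F k x)
    (hinj : ∀ x y, ∀ k < 2 * N + 1, F k x → F k y → x = y)
    (hC : ∀ j < 2 * N, ∀ x, V x → ∃ y, V y ∧ x ≠ y ∧ C j x y)
    (hsymm : ∀ j < 2 * N, ∀ x y, C j x y → C j y x)
    (hdisj : ∀ i < 2 * N, ∀ j < i, ∀ x y, ¬ (C i x y ∧ C j x y)) : False := by
  classical
  choose k hk hFk using fun x : {x // V x} => hF x x.2
  have hkinj : Function.Injective fun x => (⟨k x, hk x⟩ : Fin (2 * N + 1)) := by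
    intro x y hxy
    have h : k x = k y := congrArg Fin.val hxy
    exact Subtype.ext (hinj x y _ (hk x) (hFk x) (h ▸ hFk y))
  have : Fintype {x // V x} := Fintype.ofInjective _ hkinj
  have hle : Fintype.card {x // V x} ≤ 2 * N + 1 := by
    simpa using Fintype.card_le_of_injective _ hkinj
  have hg : ∀ (j : Fin (2 * N)) (x : {x // V x}), ∃ y : {x // V x}, x ≠ y ∧ C j x y := by
    intro j x
    obtain ⟨y, h1, h2, h3⟩ := hC j j.2 x x.2
    exact ⟨⟨y, h1⟩, fun h => h2 (congrArg Subtype.val h), h3⟩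
  choose g hgne hg using hg
  have heq : ∀ (i j : Fin (2 * N)) (x y : M), C i x y → C j x y → i = j := by
    intro i j x y h1 h2
    rcases lt_trichotomy i j with h | h | h
    · exact absurd ⟨h2, h1⟩ (hdisj j j.2 i h x y)
    · exact h
    · exact absurd ⟨h1, h2⟩ (hdisj i i.2 j h x y)
  have hginj : ∀ x, Function.Injective fun j => (⟨g j x, (hgne j x).symm⟩ : {y // y ≠ x}) := by
    intro x i j hij
    have h : g i x = g j x := congrArg Subtype.val hij
    exact heq i j x (g i x) (hg i x) (h ▸ hg j x)
  have hcard : ∀ x : {x // V x}, Fintype.card {y // y ≠ x} = Fintype.card {x // V x} - 1 := by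
    intro x
    rw [Fintype.card_subtype_compl, Fintype.card_subtype_eq]
  have hge : ∀ x : {x // V x}, 2 * N ≤ Fintype.card {x // V x} - 1 := by
    intro x
    have := Fintype.card_le_of_injective _ (hginj x)
    rwa [hcard, Fintype.card_fin] at this
  obtain ⟨x₀, hx₀⟩ := hV
  have hcardV : Fintype.card {x // V x} = 2 * N + 1 := by
    have := hge ⟨x₀, hx₀⟩
    omega
  have huniq : ∀ (j : Fin (2 * N)) (x y : {x // V x}), x ≠ y → C j x y → y = g j x := by
    intro j x y hxy h
    have hb := (Fintype.bijective_iff_injective_and_card _).2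
      ⟨hginj x, by rw [hcard, hcardV, Fintype.card_fin]; rfl⟩
    obtain ⟨i, hi⟩ := hb.2 ⟨y, hxy.symm⟩
    have hi' : g i x = y := congrArg Subtype.val hi
    rw [← hi', heq i j x y (hi' ▸ hg i x) h]
  let j₀ : Fin (2 * N) := ⟨0, by omega⟩
  have hinv : Function.Involutive (g j₀) := fun x =>
    (huniq j₀ _ _ (hgne j₀ x).symm (hsymm _ j₀.2 _ _ (hg j₀ x))).symm
  have hsq : hinv.toPerm ^ 2 = 1 := by
    ext x; simp [sq, hinv x]
  have hsupp : hinv.toPerm.support = Finset.univ := by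
    ext x; simpa using (hgne j₀ x).symm
  have h2 := Equiv.Perm.two_dvd_card_support hsq
  rw [hsupp, Finset.card_univ, hcardV] at h2
  omega

namespace Fm

variable {d : ℕ} {U J : Type*} {X : ℕ → (Fin (d + 3) → U) → J → Prop}
  {s : Fin (d + 3) → U} {c : J}

/-- Conjunction as a derived connective. -/
def and {α : ℕ} (φ ψ : Fm α) : Fm α := neg (or (neg φ) (neg ψ))

/-- The disjunction of `f k` for `k < n`. -/
def disj (f : ℕ → Fm (d + 3)) : ℕ → Fm (d + 3)
  | 0 => neg (eq 0 0)
  | n + 1 => or (disj f n) (f n)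

/-- The conjunction of `f k` for `k < n`. -/
def conj (f : ℕ → Fm (d + 3)) : ℕ → Fm (d + 3)
  | 0 => eq 0 0
  | n + 1 => and (conj f n) (f n)

theorem cSat_and {φ ψ : Fm (d + 3)} :
    CSat X s c (and φ ψ) ↔ CSat X s c φ ∧ CSat X s c ψ := by
  simp [and, CSat]

theorem cSat_disj {f : ℕ → Fm (d + 3)} {n : ℕ} :
    CSat X s c (disj f n) ↔ ∃ k < n, CSat X s c (f k) := by
  induction n with
  | zero => simp [disj, CSat]
  | succ n ih =>
    simp only [disj, CSat, ih, Nat.lt_succ_iff_lt_or_eq, or_and_right, exists_or,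
      exists_eq_left]

theorem cSat_conj {f : ℕ → Fm (d + 3)} {n : ℕ} :
    CSat X s c (conj f n) ↔ ∀ k < n, CSat X s c (f k) := by
  induction n with
  | zero => simp [conj, CSat]
  | succ n ih =>
    simp only [conj, cSat_and, ih, Nat.lt_succ_iff_lt_or_eq, or_imp, forall_and, forall_eq]

/-- The variable `v_i` takes its value in the coloured set. -/
def inSet (i : Fin (d + 3)) : Fm (d + 3) := rel 0 fun _ => i

/-- The variable `v_i` has the label `k` with respect to `v_2`. -/
def label (k : ℕ) (i : Fin (d + 3)) : Fm (d + 3) := rel (2 * k + 1) fun l => if l = 0 then i else 2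

/-- The pair of `v_0` and `v_1` has colour `j`. -/
def color (j : ℕ) : Fm (d + 3) := rel (2 * j + 2) fun l => l

/-- The pair of `v_1` and `v_0` has colour `j`. -/
def colorSwap (j : ℕ) : Fm (d + 3) := rel (2 * j + 2) fun l => Equiv.swap 0 1 l

/-- The complete graph on a set of at most `2 * N + 1` elements is the disjoint union of `2 * N`
spanning symmetric relations. -/
def oddFactorization (d N : ℕ) : Fm (d + 3) :=
  and (ex 0 (inSet 0)) <|
  and (ex 2 (and (all 0 (imp (inSet 0) (disj (fun k => label k 0) (2 * N + 1))))
    (all 0 (all 1 (conj (fun k => imp (and (label k 0) (label k 1)) (eq 0 1)) (2 * N + 1)))))) <|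
  and (conj (fun j => all 0 (imp (inSet 0)
    (ex 1 (and (inSet 1) (and (neg (eq 0 1)) (color j)))))) (2 * N)) <|
  and (conj (fun j => all 0 (all 1 (imp (color j) (colorSwap j)))) (2 * N))
    (conj (fun i => conj (fun j => all 0 (all 1 (neg (and (color i) (color j))))) i) (2 * N))

theorem cSat_oddFactorization {N : ℕ} :
    CSat X s c (oddFactorization d N) ↔
      (∃ x c, X 0 (fun _ => x) c) ∧
      (∃ (z : U), (∀ x c, X 0 (fun _ => x) c →
          ∃ k < 2 * N + 1, X (2 * k + 1) (fun l => if l = 0 then x else z) c) ∧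
        ∀ x y c, ∀ k < 2 * N + 1, X (2 * k + 1) (fun l => if l = 0 then x else z) c →
          X (2 * k + 1) (fun l => if l = 0 then y else z) c → x = y) ∧
      (∀ j < 2 * N, ∀ x c, X 0 (fun _ => x) c → ∃ y c', X 0 (fun _ => y) c' ∧ x ≠ y ∧
        X (2 * j + 2) (Function.update (Function.update s 0 x) 1 y) c') ∧
      (∀ j < 2 * N, ∀ x y c, X (2 * j + 2) (Function.update (Function.update s 0 x) 1 y) c →
        X (2 * j + 2) (fun l => Function.update (Function.update s 0 x) 1 y
          (Equiv.swap 0 1 l)) c) ∧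
      ∀ i < 2 * N, ∀ j < i, ∀ x y c,
        ¬ (X (2 * i + 2) (Function.update (Function.update s 0 x) 1 y) c ∧
          X (2 * j + 2) (Function.update (Function.update s 0 x) 1 y) c) := by
  -- Lets vacuous quantifiers over colours be dropped.
  have : Nonempty J := ⟨c⟩
  have h01 : (1 : Fin (d + 3)) ≠ 0 := by simp
  have h02 : (2 : Fin (d + 3)) ≠ 0 := Fin.ne_of_val_ne (by rw [Fin.val_two]; simp)
  have h12 : (2 : Fin (d + 3)) ≠ 1 := Fin.ne_of_val_ne (by rw [Fin.val_two]; simp)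
  have hl : ∀ (t : Fin (d + 3) → U) x z, (fun l : Fin (d + 3) =>
      Function.update (Function.update t 2 z) 0 x (if l = 0 then 0 else 2)) =
        fun l => if l = 0 then x else z := by
    intro t x z; funext l; split_ifs <;> simp [h02]
  have hl0 : ∀ (t : Fin (d + 3) → U) x y z, (fun l : Fin (d + 3) =>
      Function.update (Function.update (Function.update t 2 z) 0 x) 1 y
        (if l = 0 then 0 else 2)) = fun l => if l = 0 then x else z := by
    intro t x y z; funext l; split_ifs <;> simp [h02, h12]
  have hl1 : ∀ (t : Fin (d + 3) → U) x y z, (fun l : Fin (d + 3) =>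
      Function.update (Function.update (Function.update t 2 z) 0 x) 1 y
        (if l = 0 then 1 else 2)) = fun l => if l = 0 then y else z := by
    intro t x y z; funext l; split_ifs <;> simp [h02, h12]
  simp only [oddFactorization, inSet, label, color, colorSwap, cSat_and, cSat_conj, cSat_disj,
    cSat_all, cSat_imp, CSat, Function.update_self, Function.update_of_ne h01.symm, hl, hl0, hl1,
    forall_const, exists_const, and_imp, ne_eq]

end Fm

end FinVarLogic

/-! ### The coloured structure satisfying the factorization, and the conclusion -/

namespace FinVarLogic

open Pt Fm

variable {d : ℕ}

theorem update_update_swap {U : Type*} (s : Fin (d + 3) → U) (x y : U) :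
    (fun l => Function.update (Function.update s 0 x) 1 y (Equiv.swap 0 1 l)) =
      Function.update (Function.update s 0 y) 1 x := by
  have h01 : (0 : Fin (d + 3)) ≠ 1 := by simp
  funext l
  by_cases h1 : l = 1
  · subst h1; simp [h01]
  · by_cases h0 : l = 0
    · subst h0; simp
    · rw [Equiv.swap_apply_of_ne_of_ne h0 h1]; simp [h0, h1]

theorem valid_neg_oddFactorization {N : ℕ} (hN : 0 < N) :
    Valid.{u} (neg (oddFactorization d N)) := by
  intro M _ R a h
  obtain ⟨⟨x, _, hx⟩, ⟨z, h1, h2⟩, h3, h4, h5⟩ :=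
    cSat_oddFactorization.1 ((sat_iff_cSat R _ a).1 h)
  refine false_of_odd_factorization hN (V := fun x => R 0 fun _ => x)
    (F := fun k x => R (2 * k + 1) fun l => if l = 0 then x else z)
    (C := fun j x y => R (2 * j + 2) (Function.update (Function.update a 0 x) 1 y))
    ⟨x, hx⟩ (fun x h => h1 x () h) (fun x y k hk hx hy => h2 x y () k hk hx hy)
    (fun j hj x hx => ?_) (fun j hj x y h => ?_) (fun i hi j hj x y h => h5 i hi j hj x y () h)
  · obtain ⟨y, _, hy⟩ := h3 j hj x () hx
    exact ⟨y, hy⟩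
  · have := h4 j hj x y () h
    rwa [update_update_swap] at this

/-- The relations of the coloured structure in which `oddFactorization` holds. -/
def coloredRel (d N : ℕ) (r : ℕ) (s : Fin (d + 3) → Pt (2 * N + 1)) (c : ZMod (2 * N)) : Prop :=
  (r = 0 ∧ (s 0).isV = true) ∨
  (∃ x e, s 0 = Pt.v x ∧ s 1 = Pt.w e ∧ r = 2 * (e x).val + 1) ∨
  (Star s ∧ r = 2 * c.val + 2)

/-- Labels are invariant because `π` sends `e` to `e ∘ π⁻¹`. Having every permutation as a point `w
e` allows this, although no single labelling is invariant. -/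
theorem good_coloredRel (N r : ℕ) : Good (coloredRel d N r) := by
  refine ⟨fun s c c' h => ?_, fun π ρ s c => ?_⟩
  · simp [coloredRel, h]
  · refine or_congr (by simp [isV_perm]) (or_congr ?_ (by rw [star_perm_comp]))
    simp only [Function.comp_apply]
    rcases s 0 with x | n | e <;> rcases s 1 with y | k | f <;> simp [perm]

theorem coloredRel_zero {N : ℕ} {s : Fin (d + 3) → Pt (2 * N + 1)} {c : ZMod (2 * N)} :
    coloredRel d N 0 s c ↔ (s 0).isV = true := by
  simp [coloredRel]

theorem coloredRel_odd {N k : ℕ} {s : Fin (d + 3) → Pt (2 * N + 1)} {c : ZMod (2 * N)} :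
    coloredRel d N (2 * k + 1) s c ↔
      ∃ x e, s 0 = Pt.v x ∧ s 1 = Pt.w e ∧ k = (e x).val := by
  have h : ∀ a, 2 * k ≠ 2 * a + 1 := by omega
  simp [coloredRel, h]

theorem coloredRel_even {N k : ℕ} {s : Fin (d + 3) → Pt (2 * N + 1)} {c : ZMod (2 * N)} :
    coloredRel d N (2 * k + 2) s c ↔ Star s ∧ k = c.val := by
  have h : ∀ a, 2 * k + 1 ≠ 2 * a := by omega
  simp [coloredRel, h]

theorem star_update_update {m : ℕ} {x y : ZMod m} (h : x ≠ y) :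
    Star (Function.update (Function.update (fun l : Fin (d + 3) => Pt.z (m := m) l)
      0 (Pt.v x)) 1 (Pt.v y)) := by
  have h01 : (0 : Fin (d + 3)) ≠ 1 := by simp
  refine ⟨?_, ?_, ?_⟩
  · intro a b hab
    simp only [Function.update_apply] at hab
    split_ifs at hab <;> grind
  · have : vset (Function.update (Function.update (fun l : Fin (d + 3) => Pt.z (m := m) l)
      0 (Pt.v x)) 1 (Pt.v y)) = {0, 1} := by
      ext a
      simp only [mem_vset, Function.update_apply]
      split_ifs <;> simp_all [isV]
    rw [this, Finset.card_pair h01]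
  · intro a e
    simp only [Function.update_apply]
    split_ifs <;> simp

theorem cSat_oddFactorization_coloredRel (N : ℕ) [NeZero N] (c : ZMod (2 * N)) :
    CSat (coloredRel d N) (fun l => Pt.z l) c (oddFactorization d N) := by
  have hN : 0 < N := NeZero.pos N
  have : Fact (1 < 2 * N + 1) := ⟨by omega⟩
  refine cSat_oddFactorization.2 ⟨⟨Pt.v 0, 0, coloredRel_zero.2 rfl⟩, ⟨Pt.w 1, ?_, ?_⟩, ?_, ?_, ?_⟩
  · intro p c hp
    have hp := eq_v_of_isV (coloredRel_zero.1 hp)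
    exact ⟨p.vval.val, ZMod.val_lt _, coloredRel_odd.2 ⟨p.vval, 1, by simpa using hp, by simp, rfl⟩⟩
  · intro p q c k _ hp hq
    obtain ⟨x, e, h1, h2, h3⟩ := coloredRel_odd.1 hp
    obtain ⟨y, f, h4, h5, h6⟩ := coloredRel_odd.1 hq
    simp only [if_true, one_ne_zero, if_false, Pt.w.injEq] at h1 h2 h4 h5
    subst h2 h5 h1 h4
    exact congrArg Pt.v (ZMod.val_injective _ (h3.symm.trans h6))
  · intro j hj p c hp
    have hp := eq_v_of_isV (coloredRel_zero.1 hp)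
    have hne : p.vval ≠ p.vval + 1 := by simp
    -- Any other element of `ZMod (2 * N + 1)` would do: the quantifier supplies the colour `j`
    -- freely.
    refine ⟨Pt.v (p.vval + 1), j, coloredRel_zero.2 rfl, ?_, ?_⟩
    · rw [hp]; simp [vval]
    · rw [hp]
      exact coloredRel_even.2 ⟨star_update_update hne, (ZMod.val_cast_of_lt hj).symm⟩
  · intro j _ p q c h
    rw [coloredRel_even] at h ⊢
    exact ⟨(star_comp_iff _ _).2 h.1, h.2⟩
  · intro i _ j hj p q c h
    rw [coloredRel_even, coloredRel_even] at h
    exact hj.ne (h.2.2.trans h.1.2.symm)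

/-- Every complete axiom system contains, for each `n`, a formula with at least `n` relation symbols,
two permuted occurrences of one of them, and all of `∃`, `=` and `∨`. -/
theorem IsCompleteAxiomSystem.exists_mem (α : ℕ) (hα : 3 ≤ α) (Γ : Set (Fm α))
    (hΓ : Fm.IsCompleteAxiomSystem.{u} Γ) (n : ℕ) :
    ∃ φ ∈ Γ,
      n ≤ φ.relSymbols.card ∧
      (∃ (i : ℕ) (τ σ : Equiv.Perm (Fin α)), τ ≠ σ ∧
        φ.RelOccurs i (fun l => τ l) ∧ φ.RelOccurs i (fun l => σ l)) ∧
      (φ.ExOccurs ∧ φ.EqOccurs ∧ φ.OrOccurs) := by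
  obtain ⟨d, rfl⟩ := Nat.exists_eq_add_of_le' hα
  by_contra hcon
  -- With `n + 1` in place of `n`, formulas beyond the bound have at least two relation symbols even
  -- for `n = 0`, which forces `∨` to occur.
  set N := 2 ^ ((n + 1) * 2 ^ (d + 3)) with hN
  have : NeZero N := ⟨by positivity⟩
  have hsound : ∀ ψ ∈ Inst Γ, ∀ s c, CSat (coloredRel d N) s c ψ := by
    rintro _ ⟨φ, hφ, δ, rfl⟩ s c
    rw [cSat_inst]
    have hX : ∀ k, Good fun s c => CSat (coloredRel d N) s c (δ k) :=
      fun k => good_cSat (good_coloredRel N) (δ k)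
    have hval := hΓ.1 φ hφ
    by_cases hcard : φ.relSymbols.card ≤ n + 1
    · exact cSat_of_valid_of_card_le hN.ge hX hval hcard s c
    by_cases heq : φ.EqOccurs
    swap
    · exact cSat_of_valid_of_not_eqOccurs hX hval heq s c
    by_cases hex : φ.ExOccurs
    swap
    · exact (sat_iff_cSat_of_not_exOccurs _ c φ hex s).1 (hval.sat _ s)
    have hor : φ.OrOccurs := by
      by_contra h
      have := card_relSymbols_le_one h
      omega
    refine cSat_of_valid_of_perm_unique hX hval (fun k τ σ hτ hσ => ?_) s c
    by_contra hne
    exact hcon ⟨φ, hφ, by omega, ⟨k, τ, σ, hne, hτ, hσ⟩, hex, heq, hor⟩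
  have hder := hΓ.2 _ (valid_neg_oddFactorization (d := d) (NeZero.pos N))
  exact Derivable.cSat hsound hder _ 0 (cSat_oddFactorization_coloredRel N 0)

end FinVarLogic

theorem mainTheorem8 (α : ℕ) (hα : 3 ≤ α) (Γ : Set (FinVarLogic.Fm α))
    (hΓ : FinVarLogic.Fm.IsCompleteAxiomSystem.{u} Γ) (n : ℕ) :
    ∃ φ ∈ Γ,
      n ≤ φ.relSymbols.card ∧
      (∃ (i : ℕ) (τ σ : Equiv.Perm (Fin α)), τ ≠ σ ∧
        φ.RelOccurs i (fun l => τ l) ∧ φ.RelOccurs i (fun l => σ l)) ∧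
      (φ.ExOccurs ∧ φ.EqOccurs ∧ φ.OrOccurs) :=
  FinVarLogic.IsCompleteAxiomSystem.exists_mem α hα Γ hΓ n
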